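/- Let $n\ge 0$, let $k_0,\dots,k_n$ and $r_1,\dots,r_n$ be positive integers, and put $r_0=r_{n+1}=1$. Assume that $$r_{i}\le r_{i-1}k_{i-1}\quad\text{and}\quad r_{i-1}\le r_{i}k_{i-1}\qquad (i=1,\dots,n+1).$$ Let $V_{\mathbf k,\mathbf r}\subseteq\mathbb P\big(\bigotimes_{i=0}^n\mathbb C^{k_i}\big)$ be the tensor train variety, that is, the Zariski closure of the set of all points $[\psi]$, where $\psi\neq 0$ is a tensor with entries $$\psi_{j_0,\dots,j_n}=A_0^{(j_0)}A_1^{(j_1)}\cdots A_n^{(j_n)}\qquad(1\le j_i\le k_i)$$ for complex matrices $A_i^{(j)}\in\mathbb C^{r_i\times r_{i+1}}$ ($0\le i\le n$, $1\le j\le k_i$). Put $$d=\Big(\sum_{i=0}^{n-1}(r_ik_i-r_{i+1})\,r_{i+1}\Big)+r_nk_n .$$ Then $V_{\mathbf k,\mathbf r}$, viewed as a variety of tensors, i.e. the affine cone over $V_{\mathbf k,\mathbf r}$ in $\bigotimes_{i=0}^n\mathbb C^{k_i}$, has dimension $d$; and the projective variety $V_{\mathbf k,\mathbf r}$ has dimension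 $d-1$. -/

import Mathlib

open scoped LinearAlgebra.Projectivization

noncomputable section

namespace TensorTrain

/-- A subset of the complex projective space with homogeneous coordinates indexed by `ι` is
algebraic if it is the common zero locus of a set of homogeneous polynomials. (Vanishing of a
homogeneous polynomial does not depend on the chosen representative.) -/
def IsAlgebraicSet {ι : Type} (Z : Set (ℙ ℂ (ι → ℂ))) : Prop :=
  ∃ S : Set (MvPolynomial ι ℂ), (∀ p ∈ S, ∃ d : ℕ, p.IsHomogeneous d) ∧
    Z = {x | ∀ p ∈ S, MvPolynomial.eval x.rep p = 0}

/-- The Zariski topology on projective space: the closed sets are the algebraic sets. -/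
@[reducible]
def zariski (ι : Type) : TopologicalSpace (ℙ ℂ (ι → ℂ)) :=
  TopologicalSpace.ofClosed {Z | IsAlgebraicSet Z}
    (by
      refine ⟨{1}, fun p hp => ⟨0, ?_⟩, ?_⟩
      · rw [Set.mem_singleton_iff.1 hp]
        exact MvPolynomial.isHomogeneous_one ι ℂ
      · ext x
        simp)
    (by
      intro A hA
      choose! S hS hZ using fun Z (hZ : Z ∈ A) => hA hZ
      refine ⟨⋃ Z ∈ A, S Z, ?_, ?_⟩
      · intro p hp
        simp only [Set.mem_iUnion] at hp
        obtain ⟨Z, hZA, hp⟩ := hp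
        exact hS Z hZA p hp
      · ext x
        simp only [Set.mem_sInter, Set.mem_iUnion, Set.mem_ofPred_eq]
        constructor
        · rintro h p ⟨Z, hZA, hp⟩
          have hx := h Z hZA
          rw [hZ Z hZA] at hx
          exact hx p hp
        · intro h Z hZA
          rw [hZ Z hZA]
          exact fun p hp => h p ⟨Z, hZA, hp⟩)
    (by
      rintro _ ⟨S, hS, rfl⟩ _ ⟨T, hT, rfl⟩
      refine ⟨{f | ∃ p ∈ S, ∃ q ∈ T, f = p * q}, ?_, ?_⟩
      · rintro _ ⟨p, hp, q, hq, rfl⟩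
        obtain ⟨d, hd⟩ := hS p hp
        obtain ⟨e, he⟩ := hT q hq
        exact ⟨d + e, hd.mul he⟩
      · ext x
        constructor
        · rintro (h | h)
          · rintro _ ⟨p, hp, q, hq, rfl⟩
            rw [map_mul, h p hp, zero_mul]
          · rintro _ ⟨p, hp, q, hq, rfl⟩
            rw [map_mul, h q hq, mul_zero]
        · intro h
          by_contra hne
          simp only [Set.mem_union, Set.mem_ofPred_eq, not_or, not_forall] at hne
          obtain ⟨⟨p, hp, hp0⟩, ⟨q, hq, hq0⟩⟩ := hne
          have := h (p * q) ⟨p, hp, q, hq, rfl⟩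
          rw [map_mul] at this
          exact (mul_ne_zero hp0 hq0) this)

/-- The dimension of a subset of projective space: its Krull dimension as a topological space
(supremum of the lengths of chains of irreducible closed subsets) for the Zariski topology. -/
def projDim {ι : Type} (V : Set (ℙ ℂ (ι → ℂ))) : WithBot ℕ∞ :=
  letI : TopologicalSpace (ℙ ℂ (ι → ℂ)) := zariski ι
  topologicalKrullDim V

/-- The affine cone over a subset of projective space: the origin together with all vectors
that represent a point of `V`. -/
def affineCone {ι : Type} (V : Set (ℙ ℂ (ι → ℂ))) : Set (ι → ℂ) :=
  {v | ∀ hv : v ≠ 0, Projectivization.mk ℂ v hv ∈ V}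

/-- The dimension of an affine variety: the Krull dimension of its coordinate ring, the polynomial
ring modulo the ideal of all polynomials that vanish on it. -/
def affineDim {ι : Type} (X : Set (ι → ℂ)) : WithBot ℕ∞ :=
  ringKrullDim (MvPolynomial ι ℂ ⧸ MvPolynomial.vanishingIdeal ℂ X)

/-- The product `M 0 * M 1 * ⋯ * M (m - 1)` of matrices, where `M i` has size
`r i × r (i + 1)`. -/
def matProd : {m : ℕ} → (r : Fin (m + 1) → ℕ) →
    ((i : Fin m) → Matrix (Fin (r i.castSucc)) (Fin (r i.succ)) ℂ) →
    Matrix (Fin (r 0)) (Fin (r (Fin.last m))) ℂ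
  | 0, r, _ => (1 : Matrix (Fin (r 0)) (Fin (r 0)) ℂ)
  | _ + 1, r, M => M 0 * matProd (fun i => r i.succ) (fun i => M i.succ)

/-- The tensor with entries `ψ_{j_0, …, j_n} = A_0^{(j_0)} A_1^{(j_1)} ⋯ A_n^{(j_n)}`. The product
is a `1 × 1` matrix because `r_0 = r_{n+1} = 1`, and `ψ_{j_0, …, j_n}` is its only entry. -/
def ttTensor {n : ℕ} {k : Fin (n + 1) → ℕ} {r : Fin (n + 2) → ℕ}
    (hr0 : r 0 = 1) (hrn : r (Fin.last (n + 1)) = 1)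
    (A : (i : Fin (n + 1)) → Fin (k i) → Matrix (Fin (r i.castSucc)) (Fin (r i.succ)) ℂ) :
    ((i : Fin (n + 1)) → Fin (k i)) → ℂ :=
  fun j => matProd r (fun i => A i (j i)) ⟨0, by omega⟩ ⟨0, by omega⟩

/-- The tensor train variety `V_{k,r}`: the Zariski closure of the set of all points `[ψ]` where
`ψ` is a nonzero tensor of the form `ψ_{j_0, …, j_n} = A_0^{(j_0)} ⋯ A_n^{(j_n)}`. -/
def ttVariety {n : ℕ} (k : Fin (n + 1) → ℕ) (r : Fin (n + 2) → ℕ)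
    (hr0 : r 0 = 1) (hrn : r (Fin.last (n + 1)) = 1) :
    Set (ℙ ℂ (((i : Fin (n + 1)) → Fin (k i)) → ℂ)) :=
  letI := zariski ((i : Fin (n + 1)) → Fin (k i))
  closure {x | ∃ (A : (i : Fin (n + 1)) → Fin (k i) →
      Matrix (Fin (r i.castSucc)) (Fin (r i.succ)) ℂ) (hA : ttTensor hr0 hrn A ≠ 0),
    x = Projectivization.mk ℂ (ttTensor hr0 hrn A) hA}

end TensorTrain

end

/-!
The affine cone over the tensor train variety is the closure of the image of the polynomial map that
sends cores to their tensor. Inserting `T⁻¹ * T` between consecutive cores does not change the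
tensor, and for generic cores this freedom can be used to turn `r (i + 1)` prescribed rows of the
`i`-th core, read as an `(r i * k i) × r (i + 1)` matrix, into an identity matrix. What is left are
the scalar multiples of tensor trains with normalized cores, a family with `d` parameters
(`mem_of_isClosed_of_isNormalized`, `card_freeIndex`); the remaining parameter is the scalar.

Conversely, normalized cores are rational functions of the tensor. The prescribed rows make
every entry of the tail of a tensor train an entry of the tensor itself, and the first core then
solves a linear system whose matrix is the tail. By Cramer's rule its entries are quotients of
polynomials in the entries of the tensor, with a minor of the tail as denominator
(`exists_recovery`). The two inequalities between the `r i` and the `k i` allow cores `T` that are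
normalized and at which these denominators do not vanish (`exists_core`, `exists_columns`).

The dimension count is elementary (`dim_of_parametrization`). The coordinate ring of the cone embeds
into a polynomial ring in `d` variables, so its Krull dimension is at most `d` by Noether
normalization (`ringKrullDim_le_card_of_injective`). Irreducible closed subsets of the projective
variety give prime ideals strictly below the ideal of the origin, so the projective dimension plus
one is at most the affine dimension (`projDim_add_one_le_affineDim`). Finally, freeing the
parameters one at a time, starting from `T`, gives a chain of `d` irreducible closed subsets of the
projective variety. It is strict because the rational functions that recover the parameters
are defined at the tensor of `T` (`vanishingIdeal_imageCone_insert_not_ge`).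
-/

open scoped LinearAlgebra.Projectivization

noncomputable section

namespace TensorTrain

open MvPolynomial TopologicalSpace
open scoped Topology

/-! ### Polynomials on lines through the origin -/

lemma eval_smul_of_isHomogeneous {ι : Type} {p : MvPolynomial ι ℂ} {d : ℕ}
    (hp : p.IsHomogeneous d) (t : ℂ) (v : ι → ℂ) :
    eval (t • v) p = t ^ d * eval v p := by
  rw [eval_eq, eval_eq, Finset.mul_sum]
  refine Finset.sum_congr rfl fun e he => ?_
  have hd : ∑ i ∈ e.support, e i = d := by
    rw [← Finsupp.degree_apply]
    have := hp (mem_support_iff.1 he)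
    rwa [show (1 : ι → ℕ) = fun _ => 1 from rfl, ← Finsupp.degree_eq_weight_one] at this
  simp only [Pi.smul_apply, smul_eq_mul, mul_pow, Finset.prod_mul_distrib,
    Finset.prod_pow_eq_pow_sum, hd]
  ring

lemma forall_eval_smul_eq_zero_iff {ι : Type} (f : MvPolynomial ι ℂ) (v : ι → ℂ) :
    (∀ t : ℂ, eval (t • v) f = 0) ↔ ∀ i, eval v (homogeneousComponent i f) = 0 := by
  have key : ∀ t : ℂ, eval (t • v) f =
      ∑ i ∈ Finset.range (f.totalDegree + 1), t ^ i * eval v (homogeneousComponent i f) := by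
    intro t
    conv_lhs => rw [← sum_homogeneousComponent f]
    rw [map_sum]
    exact Finset.sum_congr rfl fun i _ =>
      eval_smul_of_isHomogeneous (homogeneousComponent_isHomogeneous i f) t v
  constructor
  · intro h i
    by_cases hi : i ∈ Finset.range (f.totalDegree + 1)
    · have h0 : (∑ i ∈ Finset.range (f.totalDegree + 1),
          Polynomial.monomial i (eval v (homogeneousComponent i f))) = 0 := by
        refine Polynomial.funext fun t => ?_
        rw [Polynomial.eval_finsetSum, Polynomial.eval_zero, ← h t, key t]
        exact Finset.sum_congr rfl fun i _ => by rw [Polynomial.eval_monomial, mul_comm]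
      have := congrArg (fun q => Polynomial.coeff q i) h0
      simp only [Polynomial.finsetSum_coeff, Polynomial.coeff_monomial,
        Finset.sum_ite_eq', hi, if_true, Polynomial.coeff_zero] at this
      exact this
    · rw [homogeneousComponent_eq_zero, map_zero]
      simpa using hi
  · intro h t
    rw [key t]
    exact Finset.sum_eq_zero fun i _ => by rw [h i, mul_zero]

/-! ### Closed subsets of projective space and ideals of cones -/

lemma isClosed_zariski_iff {ι : Type} {Z : Set (ℙ ℂ (ι → ℂ))} :
    IsClosed[zariski ι] Z ↔ IsAlgebraicSet Z := by
  rw [← @isOpen_compl_iff _ _ (zariski ι)]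
  change IsAlgebraicSet Zᶜᶜ ↔ _
  rw [compl_compl]

/-- The points of projective space on whose whole line an arbitrary, not necessarily homogeneous,
polynomial vanishes form an algebraic set, cut out by the homogeneous components. -/
lemma isAlgebraicSet_vanishing_on_line {ι : Type} (f : MvPolynomial ι ℂ) :
    IsAlgebraicSet {x : ℙ ℂ (ι → ℂ) | ∀ t : ℂ, eval (t • x.rep) f = 0} := by
  refine ⟨Set.range fun i => homogeneousComponent i f, ?_, ?_⟩
  · rintro _ ⟨i, rfl⟩
    exact ⟨i, homogeneousComponent_isHomogeneous i f⟩
  · ext x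
    simp [forall_eval_smul_eq_zero_iff]

/-- The ideal of all polynomials that vanish on the affine cone over `Z`. -/
def coneIdeal {ι : Type} (Z : Set (ℙ ℂ (ι → ℂ))) : Ideal (MvPolynomial ι ℂ) :=
  vanishingIdeal ℂ (affineCone Z)

lemma mem_vanishingIdeal_iff_eval {ι : Type} {S : Set (ι → ℂ)} {p : MvPolynomial ι ℂ} :
    p ∈ vanishingIdeal ℂ S ↔ ∀ v ∈ S, eval v p = 0 := by
  simp [mem_vanishingIdeal_iff, aeval_eq_eval]

lemma exists_eq_smul_rep {ι : Type} {v : ι → ℂ} (hv : v ≠ 0) :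
    ∃ t : ℂ, v = t • (Projectivization.mk ℂ v hv).rep := by
  obtain ⟨a, ha⟩ := Projectivization.exists_smul_eq_mk_rep ℂ v hv
  exact ⟨(a⁻¹ : ℂˣ), by rw [← ha]; exact (inv_smul_smul a v).symm⟩

lemma mem_coneIdeal_iff {ι : Type} {Z : Set (ℙ ℂ (ι → ℂ))} (hZ : Z.Nonempty)
    {f : MvPolynomial ι ℂ} :
    f ∈ coneIdeal Z ↔ ∀ x ∈ Z, ∀ t : ℂ, eval (t • x.rep) f = 0 := by
  rw [coneIdeal, mem_vanishingIdeal_iff_eval]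
  constructor
  · intro h x hx t
    refine h _ fun hv => ?_
    have ht : t ≠ 0 := fun h0 => hv (by rw [h0, zero_smul])
    have : Projectivization.mk ℂ (t • x.rep) hv = x := by
      conv_rhs => rw [← x.mk_rep]
      rw [Projectivization.mk_eq_mk_iff']
      exact ⟨t, rfl⟩
    rwa [this]
  · intro h v hv
    by_cases h0 : v = 0
    · obtain ⟨x, hx⟩ := hZ
      simpa [h0] using h x hx 0
    · obtain ⟨t, ht⟩ := exists_eq_smul_rep h0
      rw [ht]
      exact h _ (hv h0) t

lemma coneIdeal_anti {ι : Type} {Z₁ Z₂ : Set (ℙ ℂ (ι → ℂ))} (h : Z₁ ⊆ Z₂) :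
    coneIdeal Z₂ ≤ coneIdeal Z₁ :=
  vanishingIdeal_anti_mono fun _ hv h0 => h (hv h0)

/-- Passing to the Zariski closure does not change the ideal of the cone, which consists of all
polynomials and not only of the homogeneous ones. -/
lemma coneIdeal_closure {ι : Type} {Z : Set (ℙ ℂ (ι → ℂ))} (hZ : Z.Nonempty) :
    coneIdeal (@closure _ (zariski ι) Z) = coneIdeal Z := by
  let _ := zariski ι
  refine le_antisymm (coneIdeal_anti subset_closure) fun f hf => ?_
  rw [mem_coneIdeal_iff hZ] at hf
  rw [mem_coneIdeal_iff hZ.closure]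
  exact closure_minimal (s := Z) hf (isClosed_zariski_iff.2 (isAlgebraicSet_vanishing_on_line f))

/-- A closed set is determined by the ideal of its cone, since the homogeneous equations that define
the closed set vanish on the cone. -/
lemma subset_of_coneIdeal_le {ι : Type} {Z₁ Z₂ : Set (ℙ ℂ (ι → ℂ))}
    (hc : IsClosed[zariski ι] Z₁) (hn₁ : Z₁.Nonempty) (hn₂ : Z₂.Nonempty)
    (h : coneIdeal Z₁ ≤ coneIdeal Z₂) : Z₂ ⊆ Z₁ := by
  obtain ⟨S, hS, rfl⟩ := isClosed_zariski_iff.1 hc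
  intro x hx p hp
  obtain ⟨d, hd⟩ := hS p hp
  have : p ∈ coneIdeal {x : ℙ ℂ (ι → ℂ) | ∀ p ∈ S, eval x.rep p = 0} := by
    rw [mem_coneIdeal_iff hn₁]
    intro y hy t
    rw [eval_smul_of_isHomogeneous hd, hy p hp, mul_zero]
  simpa using (mem_coneIdeal_iff hn₂).1 (h this) x hx 1

lemma coneIdeal_lt {ι : Type} {Z₁ Z₂ : Set (ℙ ℂ (ι → ℂ))}
    (hc : IsClosed[zariski ι] Z₁) (hn : Z₁.Nonempty) (h : Z₁ ⊂ Z₂) :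
    coneIdeal Z₂ < coneIdeal Z₁ :=
  lt_of_le_not_ge (coneIdeal_anti h.1) fun hle =>
    h.2 (subset_of_coneIdeal_le hc hn (hn.mono h.1) hle)

lemma isPrime_coneIdeal {ι : Type} {Z : Set (ℙ ℂ (ι → ℂ))} (hZ : @IsIrreducible _ (zariski ι) Z) :
    (coneIdeal Z).IsPrime := by
  let _ := zariski ι
  refine ⟨fun htop => ?_, fun {f g} hfg => ?_⟩
  · obtain ⟨x, hx⟩ := hZ.1
    have h1 : (1 : MvPolynomial ι ℂ) ∈ coneIdeal Z := htop ▸ Submodule.mem_top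
    simpa using (mem_coneIdeal_iff hZ.1).1 h1 x hx 0
  · rw [mem_coneIdeal_iff hZ.1] at hfg ⊢
    rw [mem_coneIdeal_iff hZ.1]
    refine isPreirreducible_iff_isClosed_union_isClosed.1 hZ.2
      {x | ∀ t : ℂ, eval (t • x.rep) f = 0} {x | ∀ t : ℂ, eval (t • x.rep) g = 0}
      (isClosed_zariski_iff.2 (isAlgebraicSet_vanishing_on_line f))
      (isClosed_zariski_iff.2 (isAlgebraicSet_vanishing_on_line g)) fun x hx => ?_
    -- On a line, polynomials become polynomials in one variable, and these form a domain.
    have key : ∀ p : MvPolynomial ι ℂ, ∃ q : Polynomial ℂ, ∀ t, q.eval t = eval (t • x.rep) p := by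
      intro p
      refine ⟨aeval (fun i => Polynomial.X * Polynomial.C (x.rep i)) p, fun t => ?_⟩
      induction p using MvPolynomial.induction_on with
      | C a => simp
      | add p q hp hq => rw [map_add, Polynomial.eval_add, hp, hq, map_add]
      | mul_X p i hp =>
        rw [map_mul, aeval_X, Polynomial.eval_mul, hp, map_mul, eval_X, Polynomial.eval_mul,
          Polynomial.eval_X, Polynomial.eval_C, Pi.smul_apply, smul_eq_mul]
    obtain ⟨F, hF⟩ := key f
    obtain ⟨G, hG⟩ := key g
    have hz : F * G = 0 := Polynomial.funext fun t => by
      rw [Polynomial.eval_mul, hF, hG, ← map_mul, hfg x hx t, Polynomial.eval_zero]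
    rcases mul_eq_zero.1 hz with h0 | h0
    · exact Or.inl fun t => by rw [← hF, h0, Polynomial.eval_zero]
    · exact Or.inr fun t => by rw [← hG, h0, Polynomial.eval_zero]

/-- The converse of `isPrime_coneIdeal`; non-emptiness has to be assumed because the cone over the
empty set is the origin, whose ideal is prime. -/
lemma isIrreducible_of_isPrime_coneIdeal {ι : Type} {Z : Set (ℙ ℂ (ι → ℂ))}
    (hn : Z.Nonempty) (hp : (coneIdeal Z).IsPrime) : @IsIrreducible _ (zariski ι) Z := by
  let _ := zariski ι
  refine ⟨hn, isPreirreducible_iff_isClosed_union_isClosed.2 fun Z₁ Z₂ h₁ h₂ hsub => ?_⟩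
  by_contra! hcon
  have aux : ∀ Y : Set (ℙ ℂ (ι → ℂ)), IsClosed Y → ¬ Z ⊆ Y → Y.Nonempty →
      ∃ f ∈ coneIdeal Y, f ∉ coneIdeal Z := fun Y hY hZY hYn =>
    Set.not_subset.1 fun hle => hZY (subset_of_coneIdeal_le hY hYn hn hle)
  rcases Z₁.eq_empty_or_nonempty with rfl | hn₁
  · exact hcon.2 (by simpa using hsub)
  rcases Z₂.eq_empty_or_nonempty with rfl | hn₂
  · exact hcon.1 (by simpa using hsub)
  obtain ⟨f, hf, hfZ⟩ := aux Z₁ h₁ hcon.1 hn₁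
  obtain ⟨g, hg, hgZ⟩ := aux Z₂ h₂ hcon.2 hn₂
  refine (hp.mem_or_mem (x := f) (y := g) ?_).elim hfZ hgZ
  rw [mem_coneIdeal_iff hn]
  intro x hx t
  rw [map_mul]
  rcases hsub hx with h | h
  · rw [(mem_coneIdeal_iff hn₁).1 hf x h t, zero_mul]
  · rw [(mem_coneIdeal_iff hn₂).1 hg x h t, mul_zero]

/-- The points of projective space represented by the nonzero vectors of a set. -/
def projOf {ι : Type} (S : Set (ι → ℂ)) : Set (ℙ ℂ (ι → ℂ)) :=
  {x | ∃ v ∈ S, ∃ hv : v ≠ 0, x = Projectivization.mk ℂ v hv}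

lemma projOf_mono {ι : Type} {S T : Set (ι → ℂ)} (h : S ⊆ T) : projOf S ⊆ projOf T :=
  fun _ ⟨v, hv, h0, hx⟩ => ⟨v, h hv, h0, hx⟩

lemma projOf_nonempty {ι : Type} {S : Set (ι → ℂ)} {v : ι → ℂ} (hv : v ∈ S) (h0 : v ≠ 0) :
    (projOf S).Nonempty :=
  ⟨_, v, hv, h0, rfl⟩

lemma coneIdeal_projOf {ι : Type} {S : Set (ι → ℂ)} (hS : ∀ (t : ℂ), ∀ v ∈ S, t • v ∈ S)
    {v₀ : ι → ℂ} (hv₀ : v₀ ∈ S) (h0 : v₀ ≠ 0) : coneIdeal (projOf S) = vanishingIdeal ℂ S := by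
  ext f
  rw [mem_coneIdeal_iff (projOf_nonempty hv₀ h0), mem_vanishingIdeal_iff_eval]
  constructor
  · intro h v hv
    by_cases hz : v = 0
    · simpa [hz] using h _ ⟨v₀, hv₀, h0, rfl⟩ 0
    · obtain ⟨t, ht⟩ := exists_eq_smul_rep hz
      rw [ht]
      exact h _ ⟨v, hv, hz, rfl⟩ t
  · rintro h _ ⟨v, hv, hz, rfl⟩ t
    obtain ⟨a, ha⟩ := Projectivization.exists_smul_eq_mk_rep ℂ v hz
    rw [← ha]
    exact h _ (hS _ _ (hS (a : ℂ) _ hv))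

/-! ### Comparison of projective and affine dimension -/

/-- Irreducible closed subsets of a closed set `V` give prime ideals above the ideal of the cone
over `V`, and the ideal of the origin lies strictly above all of them. -/
lemma projDim_add_one_le_affineDim {ι : Type} {V : Set (ℙ ℂ (ι → ℂ))}
    (hV : @IsIrreducible _ (zariski ι) V) (hc : IsClosed[zariski ι] V) :
    projDim V + 1 ≤ affineDim (affineCone V) := by
  let _ := zariski ι
  rw [affineDim, ringKrullDim_quotient, projDim, topologicalKrullDim]
  have : Nonempty V := hV.1.to_subtype
  let f : IrreducibleCloseds V → Set (ℙ ℂ (ι → ℂ)) := fun Z => Subtype.val '' (Z : Set V)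
  have hirr : ∀ Z, IsIrreducible (f Z) := fun Z =>
    Z.isIrreducible.image _ continuous_subtype_val.continuousOn
  have hcl : ∀ Z, IsClosed (f Z) := fun Z => hc.isClosedMap_subtype_val _ Z.isClosed
  -- The ideal of the origin, which is the affine cone over the empty set.
  let m : Ideal (MvPolynomial ι ℂ) := vanishingIdeal ℂ ({0} : Set (ι → ℂ))
  have hm : m.IsPrime := by
    refine ⟨fun h => ?_, fun {p q} h => ?_⟩
    · have h1 : (1 : MvPolynomial ι ℂ) ∈ m := h ▸ Submodule.mem_top
      simp [m] at h1
    · simpa [m, mem_vanishingIdeal_iff_eval] using h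
  have hfm : ∀ Z, coneIdeal (f Z) < m := by
    intro Z
    refine lt_of_le_not_ge (vanishingIdeal_anti_mono ?_) fun hle => ?_
    · rintro _ rfl h
      exact absurd rfl h
    · obtain ⟨x, hx⟩ := (hirr Z).1
      refine x.rep_nonzero (funext fun i => ?_)
      have hX : (X i : MvPolynomial ι ℂ) ∈ m := by simp [m]
      simpa using (mem_coneIdeal_iff (hirr Z).1).1 (hle hX) x hx 1
  have hVm : coneIdeal V ≤ m := vanishingIdeal_anti_mono <| by
    rintro _ rfl h
    exact absurd rfl h
  -- The additional bottom element accounts for the `1` in the dimension.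
  let g : WithBot (IrreducibleCloseds V) →
      (PrimeSpectrum.zeroLocus (coneIdeal V : Set (MvPolynomial ι ℂ)))ᵒᵈ := fun Z =>
    OrderDual.toDual <| WithBot.recBotCoe ⟨⟨m, hm⟩, hVm⟩ (fun Z =>
      ⟨⟨coneIdeal (f Z), isPrime_coneIdeal (hirr Z)⟩,
        coneIdeal_anti (Subtype.coe_image_subset V Z)⟩) Z
  have hg : StrictMono g := by
    intro Z₁ Z₂ h
    induction Z₂ using WithBot.recBotCoe with
    | bot => exact absurd h not_lt_bot
    | coe Z₂ =>
      induction Z₁ using WithBot.recBotCoe with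
      | bot => exact hfm Z₂
      | coe Z₁ =>
        have hlt : Z₁ < Z₂ := WithBot.coe_lt_coe.1 h
        exact coneIdeal_lt (hcl Z₁) (hirr Z₁).1
          (Subtype.val_injective.image_strictMono hlt)
  have : Nonempty (IrreducibleCloseds V) := by
    obtain ⟨x⟩ := ‹Nonempty V›
    exact ⟨⟨closure {x}, isIrreducible_singleton.closure, isClosed_closure⟩⟩
  rw [← Order.krullDim_withBot]
  exact (Order.krullDim_le_of_strictMono g hg).trans_eq Order.krullDim_orderDual

lemma le_projDim_of_chain {ι : Type} {V : Set (ℙ ℂ (ι → ℂ))} (e : ℕ)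
    (Z : ℕ → Set (ℙ ℂ (ι → ℂ))) (hsub : ∀ s, Z s ⊆ V) (hmono : Monotone Z)
    (hirr : ∀ s, @IsIrreducible _ (zariski ι) (Z s)) (hcl : ∀ s, IsClosed[zariski ι] (Z s))
    (hlt : ∀ s < e, ¬ Z (s + 1) ⊆ Z s) : (e : WithBot ℕ∞) ≤ projDim V := by
  let _ := zariski ι
  rw [projDim, topologicalKrullDim]
  let c : Fin (e + 1) → IrreducibleCloseds V := fun s =>
    ⟨Subtype.val ⁻¹' Z s, by
      refine ⟨?_, isPreirreducible_iff_isClosed_union_isClosed.2 fun z₁ z₂ h₁ h₂ h => ?_⟩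
      · obtain ⟨x, hx⟩ := (hirr s).1
        exact ⟨⟨x, hsub s hx⟩, hx⟩
      · obtain ⟨t₁, ht₁, rfl⟩ := isClosed_induced_iff.1 h₁
        obtain ⟨t₂, ht₂, rfl⟩ := isClosed_induced_iff.1 h₂
        exact (isPreirreducible_iff_isClosed_union_isClosed.1 (hirr s).2 t₁ t₂ ht₁ ht₂
          fun x hx => h (show (⟨x, hsub s hx⟩ : V) ∈ _ from hx)).imp
          (fun hh x hx => hh hx) (fun hh x hx => hh hx), (hcl s).preimage continuous_subtype_val⟩
  refine Order.le_krullDim_iff.2 ⟨⟨e, c, fun i => ?_⟩, rfl⟩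
  refine lt_of_le_not_ge (show c i.castSucc ≤ c i.succ from
    fun x hx => hmono (by simp : (i.castSucc : ℕ) ≤ i.succ) hx) fun hle => hlt i i.2 fun x hx => ?_
  have : (⟨x, hsub _ hx⟩ : V) ∈ (c i.succ : Set V) := by simpa [c] using hx
  exact hle this

/-! ### Closures of images of polynomial maps -/

/-- By Noether normalization, a finitely generated subalgebra of a polynomial ring is integral over
a polynomial ring, whose number of variables is at most the transcendence degree. -/
lemma ringKrullDim_le_card_of_injective {K A Q : Type} [Field K] [CommRing A] [Algebra K A]
    [Algebra.FiniteType K A] [Fintype Q] (j : A →ₐ[K] MvPolynomial Q K)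
    (hj : Function.Injective j) : ringKrullDim A ≤ (Fintype.card Q : WithBot ℕ∞) := by
  have : Nontrivial A := RingHom.domain_nontrivial j.toRingHom
  obtain ⟨s, g, hg, hint⟩ := exists_integral_inj_algHom_of_fg K A
  have hs : s ≤ Fintype.card Q := by
    have := trdeg_le_of_injective (j.comp g) (hj.comp hg)
    simpa [MvPolynomial.trdeg_of_isDomain] using this
  let _ : Algebra (MvPolynomial (Fin s) K) A := g.toRingHom.toAlgebra
  have : Algebra.IsIntegral (MvPolynomial (Fin s) K) A := ⟨hint⟩
  have hle : ringKrullDim A ≤ ringKrullDim (MvPolynomial (Fin s) K) :=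
    Order.krullDim_le_of_strictMono
      (fun p => PrimeSpectrum.comap (algebraMap (MvPolynomial (Fin s) K) A) p)
      fun p q hpq => Ideal.IsIntegral.comap_lt_comap (I := p.asIdeal) (J := q.asIdeal) hpq
  refine hle.trans ?_
  rw [MvPolynomial.ringKrullDim_of_isNoetherianRing, ringKrullDim_eq_zero_of_field, zero_add,
    Nat.card_eq_fintype_card, Fintype.card_fin]
  exact_mod_cast hs

lemma vanishingIdeal_range_eq_ker {ι Q : Type} (ω : ι → MvPolynomial Q ℂ) :
    vanishingIdeal ℂ (Set.range fun (y : Q → ℂ) j => eval y (ω j)) = RingHom.ker (aeval ω) := by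
  have key : ∀ (y : Q → ℂ) f, eval y (aeval ω f) = eval (fun j => eval y (ω j)) f := by
    intro y f
    induction f using MvPolynomial.induction_on with
    | C a => simp
    | add p q hp hq => simp only [map_add, hp, hq]
    | mul_X p i hp => simp only [map_mul, hp, aeval_X, eval_X]
  ext f
  rw [mem_vanishingIdeal_iff_eval, RingHom.mem_ker, Set.forall_mem_range]
  constructor
  · intro h
    exact MvPolynomial.funext fun y => by rw [key, h y, map_zero]
  · intro h y
    rw [← key, h, map_zero]

section Parametrization

variable {ι P : Type} (θ : ι → MvPolynomial P ℂ)

/-- The value at `b` of the polynomial map with components `θ`. -/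
def polyMap (b : P → ℂ) : ι → ℂ := fun j => eval b (θ j)

/-- The cone over the image under `polyMap θ` of the coordinate subspace of all `b` that vanish
outside `W`. -/
def imageCone (W : Set P) : Set (ι → ℂ) :=
  {v | ∃ (t : ℂ) (b : P → ℂ), (∀ p ∉ W, b p = 0) ∧ v = t • polyMap θ b}

lemma imageCone_mono {W W' : Set P} (h : W ⊆ W') : imageCone θ W ⊆ imageCone θ W' :=
  fun _ ⟨t, b, hb, hv⟩ => ⟨t, b, fun p hp => hb p fun hpW => hp (h hpW), hv⟩

lemma smul_mem_imageCone {W : Set P} (c : ℂ) {v : ι → ℂ} (hv : v ∈ imageCone θ W) :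
    c • v ∈ imageCone θ W := by
  obtain ⟨t, b, hb, rfl⟩ := hv
  exact ⟨c * t, b, hb, (mul_smul c t _).symm⟩

open Classical in
/-- The cone over the image of a coordinate subspace is itself the image of a polynomial map: the
additional variable `none` is the scaling factor. -/
lemma imageCone_eq_range (W : Set P) :
    imageCone θ W = Set.range fun (y : Option P → ℂ) j => eval y
      (X none * aeval (fun p => if p ∈ W then (X (some p) : MvPolynomial (Option P) ℂ) else 0)
        (θ j)) := by
  have key : ∀ (y : Option P → ℂ) (f : MvPolynomial P ℂ),
      eval y (aeval (fun p => if p ∈ W then (X (some p) : MvPolynomial (Option P) ℂ) else 0) f) =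
        eval (fun p => if p ∈ W then y (some p) else 0) f := by
    intro y f
    induction f using MvPolynomial.induction_on with
    | C a => simp
    | add p q hp hq => simp only [map_add, hp, hq]
    | mul_X p i hp =>
      simp only [map_mul, hp, aeval_X, eval_X]
      split_ifs <;> simp
  ext v
  simp only [map_mul, eval_X, key]
  constructor
  · rintro ⟨t, b, hb, rfl⟩
    refine ⟨fun o => o.elim t b, funext fun j => ?_⟩
    have : (fun p => if p ∈ W then b p else 0) = b := by
      funext p
      by_cases hp : p ∈ W
      · simp [hp]
      · simp [hp, hb p hp]
    simp [this, polyMap]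
  · rintro ⟨y, rfl⟩
    exact ⟨y none, fun p => if p ∈ W then y (some p) else 0, fun p hp => if_neg hp, rfl⟩

lemma isPrime_vanishingIdeal_imageCone (W : Set P) :
    (vanishingIdeal ℂ (imageCone θ W)).IsPrime := by
  rw [imageCone_eq_range, vanishingIdeal_range_eq_ker]
  exact RingHom.ker_isPrime _

lemma ringKrullDim_quotient_imageCone_le [Finite ι] [Fintype P] (W : Set P) :
    ringKrullDim (MvPolynomial ι ℂ ⧸ vanishingIdeal ℂ (imageCone θ W)) ≤
      (Fintype.card P + 1 : ℕ) := by
  rw [imageCone_eq_range, vanishingIdeal_range_eq_ker, ← Fintype.card_option]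
  exact ringKrullDim_le_card_of_injective (Ideal.kerLiftAlg _) (RingHom.kerLift_injective _)

/-- If every parameter is a rational function `g p / h p` of the image point, with `h p` not
vanishing at the image of the origin, then enlarging the coordinate subspace by one coordinate
enlarges the Zariski closure of the cone over its image. -/
lemma vanishingIdeal_imageCone_insert_not_ge {W : Set P} {p : P} (hp : p ∉ W)
    {g h : MvPolynomial ι ℂ}
    (hgh : ∀ (t : ℂ) (b : P → ℂ),
      eval (t • polyMap θ b) g = b p * eval (t • polyMap θ b) h)
    (hh : eval (polyMap θ 0) h ≠ 0) :
    ¬ vanishingIdeal ℂ (imageCone θ W) ≤ vanishingIdeal ℂ (imageCone θ (insert p W)) := by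
  classical
  intro hle
  have hg : g ∈ vanishingIdeal ℂ (imageCone θ W) := by
    rw [mem_vanishingIdeal_iff_eval]
    rintro _ ⟨t, b, hb, rfl⟩
    rw [hgh, hb p hp, zero_mul]
  have hg' := mem_vanishingIdeal_iff_eval.1 (hle hg)
  -- On the `p`-th coordinate axis, `h` does not vanish near the origin.
  let F : ℂ → ℂ := fun ε => eval (polyMap θ (Pi.single p ε)) h
  have hF : Continuous F := by
    refine (MvPolynomial.continuous_eval h).comp (continuous_pi fun j => ?_)
    exact (MvPolynomial.continuous_eval (θ j)).comp (continuous_single (A := fun _ => ℂ) p)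
  have hF0 : F 0 ≠ 0 := by simpa [F] using hh
  obtain ⟨ε, hε, hε0⟩ := ((hF.continuousAt.eventually_ne hF0).filter_mono
    nhdsWithin_le_nhds |>.and (self_mem_nhdsWithin : ({0}ᶜ : Set ℂ) ∈ 𝓝[≠] 0)).exists
  have h1 := hgh 1 (Pi.single p ε)
  rw [hg' _ ⟨1, Pi.single p ε, fun q hq => ?_, rfl⟩, one_smul, Pi.single_eq_same] at h1
  · exact mul_ne_zero hε0 hε h1.symm
  · exact Pi.single_eq_of_ne (fun hqp : q = p => hq (hqp ▸ Set.mem_insert _ _)) _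

/-- A cone `S` with a Zariski dense subset of the form `{t • polyMap θ b}`, where each of the
parameters is a rational function of the image point that is defined at the image of the origin,
has the dimension that the parameter count predicts. -/
theorem dim_of_parametrization [Finite ι] [Fintype P] (g h : P → MvPolynomial ι ℂ)
    (hgh : ∀ (p : P) (t : ℂ) (b : P → ℂ),
      eval (t • polyMap θ b) (g p) = b p * eval (t • polyMap θ b) (h p))
    (hh : ∀ p, eval (polyMap θ 0) (h p) ≠ 0) (h0 : polyMap θ 0 ≠ 0)
    {S : Set (ι → ℂ)} (hS : ∀ (t : ℂ), ∀ v ∈ S, t • v ∈ S) (hθS : ∀ b, polyMap θ b ∈ S)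
    (hSθ : ∀ f : MvPolynomial ι ℂ, (∀ (t : ℂ) b, eval (t • polyMap θ b) f = 0) →
      ∀ v ∈ S, eval v f = 0) :
    affineDim (affineCone (@closure _ (zariski ι) (projOf S))) = (Fintype.card P + 1 : ℕ) ∧
    projDim (@closure _ (zariski ι) (projOf S)) + 1 = (Fintype.card P + 1 : ℕ) := by
  let _ := zariski ι
  have h0S : polyMap θ 0 ∈ S := hθS 0
  have hsub : ∀ W, imageCone θ W ⊆ S := by
    rintro W _ ⟨t, b, -, rfl⟩
    exact hS t _ (hθS b)
  have h0W : ∀ W, polyMap θ 0 ∈ imageCone θ W := fun W => ⟨1, 0, fun _ _ => rfl, by simp⟩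
  have hideal : vanishingIdeal ℂ S = vanishingIdeal ℂ (imageCone θ Set.univ) := by
    refine le_antisymm (vanishingIdeal_anti_mono (hsub _)) fun f hf => ?_
    rw [mem_vanishingIdeal_iff_eval] at hf ⊢
    exact hSθ f fun t b => hf _ ⟨t, b, fun p hp => absurd trivial hp, rfl⟩
  have hV : coneIdeal (closure (projOf S)) = vanishingIdeal ℂ (imageCone θ Set.univ) := by
    rw [coneIdeal_closure (projOf_nonempty h0S h0), coneIdeal_projOf hS h0S h0, hideal]
  have hVirr : IsIrreducible (closure (projOf S)) :=
    isIrreducible_of_isPrime_coneIdeal (projOf_nonempty h0S h0).closure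
      (hV ▸ isPrime_vanishingIdeal_imageCone θ _)
  have hupper : affineDim (affineCone (closure (projOf S))) ≤ (Fintype.card P + 1 : ℕ) := by
    have := ringKrullDim_quotient_imageCone_le θ Set.univ
    rw [← hV] at this
    exact this
  have hmid := projDim_add_one_le_affineDim hVirr isClosed_closure
  let e := Fintype.equivFin P
  -- The parameters are freed one by one, in the order of an enumeration.
  let W : ℕ → Set P := fun s => {p | (e p : ℕ) < s}
  have hW : Monotone W := fun a b hab p (hp : _ < a) => lt_of_lt_of_le hp hab
  have hZ : ∀ s, coneIdeal (closure (projOf (imageCone θ (W s)))) =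
      vanishingIdeal ℂ (imageCone θ (W s)) := fun s => by
    rw [coneIdeal_closure (projOf_nonempty (h0W _) h0),
      coneIdeal_projOf (fun c v hv => smul_mem_imageCone θ c hv) (h0W _) h0]
  have hlower : (Fintype.card P : WithBot ℕ∞) ≤ projDim (closure (projOf S)) := by
    refine le_projDim_of_chain _ (fun s => closure (projOf (imageCone θ (W s))))
      (fun s => closure_mono (projOf_mono (hsub _)))
      (fun a b hab => closure_mono (projOf_mono (imageCone_mono θ (hW hab))))
      (fun s => isIrreducible_of_isPrime_coneIdeal (projOf_nonempty (h0W _) h0).closure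
        (hZ s ▸ isPrime_vanishingIdeal_imageCone θ _))
      (fun s => isClosed_closure) fun s hs hle => ?_
    have hle' := coneIdeal_anti hle
    rw [hZ, hZ] at hle'
    let p := e.symm ⟨s, hs⟩
    have hp : p ∉ W s := by simp [W, p]
    have hins : W (s + 1) = insert p (W s) := by
      ext q
      simp only [W, p, Set.mem_ofPred_eq, Set.mem_insert_iff, Equiv.eq_symm_apply, Fin.ext_iff]
      omega
    rw [hins] at hle'
    exact vanishingIdeal_imageCone_insert_not_ge θ hp (hgh p) (hh p) hle'
  have hlower' : ((Fintype.card P + 1 : ℕ) : WithBot ℕ∞) ≤ projDim (closure (projOf S)) + 1 := by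
    push_cast
    gcongr
  exact ⟨le_antisymm hupper (hlower'.trans hmid), le_antisymm (hmid.trans hupper) hlower'⟩

end Parametrization

/-! ### Tensor trains with matrix ends -/

/-- A family of cores `A_i^{(j)}`. The end dimensions `r 0` and `r (Fin.last m)` are arbitrary, so
that removing the first core of a tensor train leaves a tensor train. -/
abbrev Cores {m : ℕ} (k : Fin m → ℕ) (r : Fin (m + 1) → ℕ) : Type :=
  (i : Fin m) → Fin (k i) → Matrix (Fin (r i.castSucc)) (Fin (r i.succ)) ℂ

/-- The matrix-valued tensor with entries `A_0^{(j_0)} ⋯ A_{m-1}^{(j_{m-1})}`. -/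
def ttMat {m : ℕ} {k : Fin m → ℕ} {r : Fin (m + 1) → ℕ} (A : Cores k r)
    (j : (i : Fin m) → Fin (k i)) : Matrix (Fin (r 0)) (Fin (r (Fin.last m))) ℂ :=
  matProd r fun i => A i (j i)

/-- The tensor train without its first core. -/
def Cores.tail {m : ℕ} {k : Fin (m + 1) → ℕ} {r : Fin (m + 2) → ℕ} (A : Cores k r) :
    Cores (fun i => k i.succ) (fun i => r i.succ) :=
  fun i => A i.succ

lemma ttMat_succ {m : ℕ} {k : Fin (m + 1) → ℕ} {r : Fin (m + 2) → ℕ} (A : Cores k r)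
    (j : (i : Fin (m + 1)) → Fin (k i)) :
    ttMat A j = A 0 (j 0) * ttMat A.tail (fun i => j i.succ) := rfl

lemma ttMat_cons {m : ℕ} {k : Fin (m + 1) → ℕ} {r : Fin (m + 2) → ℕ} (A : Cores k r)
    (a : Fin (k 0)) (j : (i : Fin m) → Fin (k i.succ)) :
    ttMat A (Fin.cons a j : (i : Fin (m + 1)) → Fin (k i)) = A 0 a * ttMat A.tail j := rfl

lemma mul_apply_of_column_eq_one {a b c : ℕ} {M : Matrix (Fin a) (Fin b) ℂ}
    {N : Matrix (Fin b) (Fin c) ℂ} {α : Fin a} {ω : Fin c} {δ : Fin b}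
    (h : ∀ β, N β ω = (1 : Matrix _ _ ℂ) β δ) : (M * N) α ω = M α δ := by
  simp [Matrix.mul_apply, h, Matrix.one_apply]

lemma mul_apply_of_row_eq_one {a b c : ℕ} {M : Matrix (Fin a) (Fin b) ℂ}
    {N : Matrix (Fin b) (Fin c) ℂ} {α : Fin a} {ω : Fin c} {δ : Fin b}
    (h : ∀ β, M α β = (1 : Matrix _ _ ℂ) δ β) : (M * N) α ω = N δ ω := by
  simp [Matrix.mul_apply, h, Matrix.one_apply]

/-- If the entries of the cores depend polynomially on parameters, so do those of the tensor. -/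
lemma exists_poly_ttMat {P : Type} {m : ℕ} {k : Fin m → ℕ} {r : Fin (m + 1) → ℕ}
    (A : (P → ℂ) → Cores k r)
    (hA : ∀ i a α β, ∃ p : MvPolynomial P ℂ, ∀ b, eval b p = A b i a α β)
    (j : (i : Fin m) → Fin (k i)) (α : Fin (r 0)) (ω : Fin (r (Fin.last m))) :
    ∃ p : MvPolynomial P ℂ, ∀ b, eval b p = ttMat (A b) j α ω := by
  induction m with
  | zero =>
    refine ⟨C ((1 : Matrix (Fin (r 0)) (Fin (r 0)) ℂ) α ω), fun b => ?_⟩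
    rw [eval_C]
    rfl
  | succ m ih =>
    choose p hp using fun β => hA 0 (j 0) α β
    choose q hq using fun β : Fin (r (Fin.succ 0)) =>
      ih (fun b => (A b).tail) (fun i => hA i.succ) (fun i => j i.succ) β ω
    refine ⟨∑ β, p β * q β, fun b => ?_⟩
    simp only [map_sum, map_mul, hp, hq, ttMat_succ]
    rfl

/-- Cores are normalized at `σ` if the rows `σ i β` of the matrix with rows indexed by
`(α, a)` and columns indexed by `β`, with entries `A_i^{(a)}(α, β)`, form an identity matrix. -/
def IsNormalized {m : ℕ} {k : Fin m → ℕ} {r : Fin (m + 1) → ℕ}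
    (σ : (i : Fin m) → Fin (r i.succ) → Fin (r i.castSucc) × Fin (k i)) (A : Cores k r) : Prop :=
  ∀ i β' β, A i (σ i β').2 (σ i β').1 β = (1 : Matrix _ _ ℂ) β' β

lemma IsNormalized.injective {m : ℕ} {k : Fin m → ℕ} {r : Fin (m + 1) → ℕ}
    {σ : (i : Fin m) → Fin (r i.succ) → Fin (r i.castSucc) × Fin (k i)} {A : Cores k r}
    (hA : IsNormalized σ A) (i : Fin m) : Function.Injective (σ i) := by
  intro β β' h
  have h1 := hA i β' β
  rw [← h, hA i β β, Matrix.one_apply_eq] at h1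
  by_contra hne
  rw [Matrix.one_apply_ne (Ne.symm hne)] at h1
  exact one_ne_zero h1

lemma IsNormalized.tail {m : ℕ} {k : Fin (m + 1) → ℕ} {r : Fin (m + 2) → ℕ}
    {σ : (i : Fin (m + 1)) → Fin (r i.succ) → Fin (r i.castSucc) × Fin (k i)} {A : Cores k r}
    (hA : IsNormalized σ A) :
    IsNormalized (k := fun i => k i.succ) (r := fun i => r i.succ) (fun i => σ i.succ) A.tail :=
  fun i => hA i.succ

/-! ### Normalized tensor trains are dense -/

/-- Adding a small nonzero multiple of `1` to a matrix makes it invertible, since the characteristic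
polynomial has finitely many roots. -/
lemma eventually_det_add_smul_one_ne_zero {n : ℕ} (T : Matrix (Fin n) (Fin n) ℂ) :
    ∀ᶠ t : ℂ in 𝓝[≠] 0, (T + t • (1 : Matrix (Fin n) (Fin n) ℂ)).det ≠ 0 := by
  have hfin : {t : ℂ | (-T).charpoly.IsRoot t}.Finite :=
    Polynomial.finite_setOfPred_isRoot (Matrix.charpoly_monic _).ne_zero
  filter_upwards [nhdsNE_le_cofinite 0 hfin.compl_mem_cofinite] with t ht hdet
  refine ht ?_
  change Polynomial.eval t (-T).charpoly = 0
  rw [Matrix.eval_charpoly, ← hdet, sub_neg_eq_add, add_comm, Matrix.smul_one_eq_diagonal]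
  rfl

/-- A closed set of matrix-valued tensors that contains all normalized tensor trains, multiplied on
the right by an arbitrary matrix, contains all tensor trains. If the block `T` of the first core
at `σ 0` is invertible, one replaces the first core by its product with `T⁻¹` and moves `T` to the
rest of the tensor train; the general case follows by adding small multiples of `1` to `T`. -/
lemma mem_of_isClosed_of_isNormalized {m : ℕ} {k : Fin m → ℕ} {r : Fin (m + 1) → ℕ}
    (σ : (i : Fin m) → Fin (r i.succ) → Fin (r i.castSucc) × Fin (k i))
    (hσ : ∀ i, Function.Injective (σ i))
    (Z : Set (((i : Fin m) → Fin (k i)) → Matrix (Fin (r 0)) (Fin (r (Fin.last m))) ℂ))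
    (hZ : IsClosed Z)
    (H : ∀ A : Cores k r, IsNormalized σ A →
      ∀ G : Matrix (Fin (r (Fin.last m))) (Fin (r (Fin.last m))) ℂ, (fun j => ttMat A j * G) ∈ Z)
    (A : Cores k r) (G : Matrix (Fin (r 0)) (Fin (r 0)) ℂ) : (fun j => G * ttMat A j) ∈ Z := by
  induction m with
  | zero =>
    have := H A (fun i => i.elim0) G
    have h1 : ∀ X : Matrix (Fin (r 0)) (Fin (r 0)) ℂ, X = 1 → G * X = X * G := by
      rintro _ rfl
      rw [mul_one, one_mul]
    have h2 : (fun j => G * ttMat A j) = _ := funext fun j => h1 (ttMat A j) rfl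
    rw [h2]
    exact this
  | succ m ih =>
    let F : (Fin (k 0) → Matrix (Fin (r 0)) (Fin (r (Fin.succ 0))) ℂ) →
        (((i : Fin (m + 1)) → Fin (k i)) → Matrix (Fin (r 0)) (Fin (r (Fin.last (m + 1)))) ℂ) :=
      fun B j => B (j 0) * ttMat A.tail fun i => j i.succ
    let T : (Fin (k 0) → Matrix (Fin (r 0)) (Fin (r (Fin.succ 0))) ℂ) →
        Matrix (Fin (r (Fin.succ 0))) (Fin (r (Fin.succ 0))) ℂ :=
      fun B => Matrix.of fun β' β => B (σ 0 β').2 (σ 0 β').1 β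
    have hinv : ∀ B, (T B).det ≠ 0 → F B ∈ Z := by
      intro B hB
      let B' : Fin (k 0) → Matrix (Fin (r 0)) (Fin (r (Fin.succ 0))) ℂ := fun a => B a * (T B)⁻¹
      have hT : T B * (T B)⁻¹ = 1 := Matrix.mul_nonsing_inv _ (isUnit_iff_ne_zero.2 hB)
      have hT' : (T B)⁻¹ * T B = 1 := Matrix.nonsing_inv_mul _ (isUnit_iff_ne_zero.2 hB)
      have := ih (k := fun i => k i.succ) (r := fun i => r i.succ) (fun i => σ i.succ)
        (fun i => hσ i.succ)
        {X | (fun j : (i : Fin (m + 1)) → Fin (k i) => B' (j 0) * X fun i => j i.succ) ∈ Z}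
        (hZ.preimage (continuous_pi fun j => continuous_const.matrix_mul (continuous_apply _)))
        (fun A' hA' G' => ?_) A.tail (T B)
      · have h2 : (fun j : (i : Fin (m + 1)) → Fin (k i) =>
            B' (j 0) * (T B * ttMat A.tail fun i => j i.succ)) = F B := by
          funext j
          rw [← Matrix.mul_assoc, Matrix.mul_assoc (B (j 0)), hT', Matrix.mul_one]
        rw [← h2]
        exact this
      · let A'' : Cores k r := Fin.cons (α := fun i : Fin (m + 1) =>
          Fin (k i) → Matrix (Fin (r i.castSucc)) (Fin (r i.succ)) ℂ) B' A'
        have hA'' : IsNormalized σ A'' := by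
          intro i
          refine Fin.cases (fun β' β => ?_) (fun i => hA' i) i
          have := congrFun (congrFun hT β') β
          exact this
        let G'' : Matrix (Fin (r (Fin.last (m + 1)))) (Fin (r (Fin.last (m + 1)))) ℂ := G'
        have := H A'' hA'' G''
        have h3 : (fun j => ttMat A'' j * G'') =
            fun j => B' (j 0) * ((ttMat A' fun i => j i.succ) * G') := by
          funext j
          exact Matrix.mul_assoc _ _ _
        rw [h3] at this
        exact this
    have hall : ∀ B, F B ∈ Z := by
      intro B
      let σ₀ : Fin (r (Fin.succ 0)) → Fin (r 0) × Fin (k 0) := σ 0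
      have hσ₀ : Function.Injective σ₀ := hσ 0
      let E : Fin (k 0) → Matrix (Fin (r 0)) (Fin (r (Fin.succ 0))) ℂ :=
        fun a => Matrix.of fun α β => if σ₀ β = (α, a) then 1 else 0
      have hE : T E = 1 := by
        ext β' β
        change (if σ₀ β = σ₀ β' then (1 : ℂ) else 0) = _
        simp only [Matrix.one_apply, hσ₀.eq_iff, @eq_comm _ β]
      have hTB : ∀ t : ℂ, T (B + t • E) = T B + t • (1 : Matrix _ _ ℂ) := by
        intro t
        rw [← hE]
        rfl
      have hcont : Continuous fun t : ℂ => F (B + t • E) := by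
        refine continuous_pi fun j => Continuous.matrix_mul ?_ continuous_const
        exact (continuous_apply (j 0)).comp
          (continuous_const.add (continuous_id.smul continuous_const))
      have hlim : Filter.Tendsto (fun t : ℂ => F (B + t • E)) (𝓝[≠] 0) (𝓝 (F B)) := by
        have := (hcont.tendsto 0).mono_left (nhdsWithin_le_nhds (s := {0}ᶜ))
        rwa [zero_smul, add_zero] at this
      refine hZ.mem_of_tendsto hlim ?_
      filter_upwards [eventually_det_add_smul_one_ne_zero (T B)] with t ht
      exact hinv _ (by rwa [hTB])
    let A₀ : Fin (k 0) → Matrix (Fin (r 0)) (Fin (r (Fin.succ 0))) ℂ := A 0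
    have := hall fun a => G * A₀ a
    have h4 : (fun j => G * ttMat A j) = F fun a => G * A₀ a := by
      funext j
      exact (Matrix.mul_assoc _ _ _).symm
    rw [h4]
    exact this

/-! ### Recovering normalized cores from the tensor -/

/-- If every core, read as a matrix with rows `α` and columns `(a, β)`, has an identity submatrix,
then so has the whole tensor train. -/
lemma exists_columns {m : ℕ} {k : Fin m → ℕ} {r : Fin (m + 1) → ℕ} (T : Cores k r)
    (τ : (i : Fin m) → Fin (r i.castSucc) → Fin (k i) × Fin (r i.succ))
    (hτ : ∀ i α α', T i (τ i α').1 α (τ i α').2 = (1 : Matrix _ _ ℂ) α α') :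
    ∃ c : Fin (r 0) → ((i : Fin m) → Fin (k i)) × Fin (r (Fin.last m)),
      ∀ α γ, ttMat T (c γ).1 α (c γ).2 = (1 : Matrix _ _ ℂ) α γ := by
  induction m with
  | zero => exact ⟨fun γ => (fun i => i.elim0, γ), fun α γ => rfl⟩
  | succ m ih =>
    obtain ⟨c, hc⟩ := ih T.tail (fun i => τ i.succ) (fun i => hτ i.succ)
    refine ⟨fun γ => (Fin.cons (τ 0 γ).1 (c (τ 0 γ).2).1, (c (τ 0 γ).2).2), fun α γ => ?_⟩
    exact (mul_apply_of_column_eq_one fun β => hc β _).trans (hτ 0 α γ)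

/-- All scalar entries of a scaled matrix-valued tensor train. -/
def ttEntries {m : ℕ} {k : Fin m → ℕ} {r : Fin (m + 1) → ℕ} (t : ℂ) (A : Cores k r) :
    ((i : Fin m) → Fin (k i)) × Fin (r 0) × Fin (r (Fin.last m)) → ℂ :=
  fun q => t * ttMat A q.1 q.2.1 q.2.2

/-- Normalization makes every entry of the tail of a tensor train an entry of the tensor train; this
is the map of index sets. -/
def headIndex {m : ℕ} {k : Fin (m + 1) → ℕ} {r : Fin (m + 2) → ℕ}
    (σ : Fin (r (Fin.succ 0)) → Fin (r 0) × Fin (k 0))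
    (q : ((i : Fin m) → Fin (k i.succ)) × Fin (r (Fin.succ 0)) × Fin (r (Fin.last (m + 1)))) :
    ((i : Fin (m + 1)) → Fin (k i)) × Fin (r 0) × Fin (r (Fin.last (m + 1))) :=
  (Fin.cons (σ q.2.1).2 q.1, (σ q.2.1).1, q.2.2)

lemma ttEntries_tail {m : ℕ} {k : Fin (m + 1) → ℕ} {r : Fin (m + 2) → ℕ}
    {σ : (i : Fin (m + 1)) → Fin (r i.succ) → Fin (r i.castSucc) × Fin (k i)} {A : Cores k r}
    (hA : IsNormalized σ A) (t : ℂ) :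
    ttEntries t A.tail = ttEntries t A ∘ headIndex (k := k) (r := r) (σ 0) := by
  funext q
  simp only [ttEntries, headIndex, Function.comp_apply, ttMat_cons]
  congr 1
  exact (mul_apply_of_row_eq_one fun β => hA 0 q.2.1 β).symm

/-- Every entry of a normalized core is a rational function `g / h` of the entries of the scaled
tensor, and `h` does not vanish at a given normalized `T` with identity submatrices as in
`exists_columns`. For the first core, `h` is a minor of the tail and `g / h` is Cramer's rule;
scaling the tensor scales both sides of the linear system for the core. -/
lemma exists_recovery {m : ℕ} {k : Fin m → ℕ} {r : Fin (m + 1) → ℕ}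
    (σ : (i : Fin m) → Fin (r i.succ) → Fin (r i.castSucc) × Fin (k i))
    (T : Cores k r) (hT : IsNormalized σ T)
    (τ : (i : Fin m) → Fin (r i.castSucc) → Fin (k i) × Fin (r i.succ))
    (hτ : ∀ i α α', T i (τ i α').1 α (τ i α').2 = (1 : Matrix _ _ ℂ) α α')
    (i : Fin m) (a : Fin (k i)) (α : Fin (r i.castSucc)) (β : Fin (r i.succ)) :
    ∃ g h : MvPolynomial (((i : Fin m) → Fin (k i)) × Fin (r 0) × Fin (r (Fin.last m))) ℂ,
      (∀ A : Cores k r, IsNormalized σ A → ∀ t,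
        eval (ttEntries t A) g = A i a α β * eval (ttEntries t A) h) ∧
      eval (ttEntries 1 T) h ≠ 0 := by
  induction m with
  | zero => exact i.elim0
  | succ m ih =>
    induction i using Fin.cases with
    | succ i =>
      obtain ⟨g, h, hgh, hh⟩ := ih (fun i => σ i.succ) T.tail hT.tail (fun i => τ i.succ)
        (fun i => hτ i.succ) i a α β
      refine ⟨rename (headIndex (k := k) (r := r) (σ 0)) g,
        rename (headIndex (k := k) (r := r) (σ 0)) h, fun A hA t => ?_, ?_⟩
      · rw [eval_rename, eval_rename, ← ttEntries_tail hA]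
        exact hgh A.tail hA.tail t
      · rw [eval_rename, ← ttEntries_tail hT]
        exact hh
    | zero =>
      obtain ⟨c, hc⟩ := exists_columns T.tail (fun i => τ i.succ) (fun i => hτ i.succ)
      let M : Matrix (Fin (r (Fin.succ 0))) (Fin (r (Fin.succ 0))) (MvPolynomial
          (((i : Fin (m + 1)) → Fin (k i)) × Fin (r 0) × Fin (r (Fin.last (m + 1)))) ℂ) :=
        Matrix.of fun β γ => X (headIndex (k := k) (r := r) (σ 0) ((c γ).1, β, (c γ).2))
      let v : Fin (r (Fin.succ 0)) → MvPolynomial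
          (((i : Fin (m + 1)) → Fin (k i)) × Fin (r 0) × Fin (r (Fin.last (m + 1)))) ℂ :=
        fun γ => X (Fin.cons a (c γ).1, α, (c γ).2)
      have hM : ∀ A : Cores k r, IsNormalized σ A → ∀ t,
          (eval (ttEntries t A)).mapMatrix M =
            Matrix.of fun β γ => t * ttMat A.tail (c γ).1 β (c γ).2 := by
        intro A hA t
        ext β γ
        have := congrFun (ttEntries_tail hA t) ((c γ).1, β, (c γ).2)
        simp only [RingHom.mapMatrix_apply, Matrix.map_apply, M, Matrix.of_apply, eval_X]
        exact this.symm
      refine ⟨Matrix.vecMul v M.adjugate β, M.det, fun A hA t => ?_, ?_⟩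
      · have hv : (fun γ => eval (ttEntries t A) (v γ)) =
            Matrix.vecMul (A 0 a α) ((eval (ttEntries t A)).mapMatrix M) := by
          funext γ
          rw [hM A hA]
          simp only [v, eval_X, ttEntries, ttMat_cons, Matrix.vecMul, dotProduct, Matrix.of_apply]
          rw [Matrix.mul_apply, Finset.mul_sum]
          exact Finset.sum_congr rfl fun δ _ => by ring
        have hg : eval (ttEntries t A) (Matrix.vecMul v M.adjugate β) =
            Matrix.vecMul (fun γ => eval (ttEntries t A) (v γ))
              ((eval (ttEntries t A)).mapMatrix M).adjugate β := by
          rw [← RingHom.map_adjugate]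
          simp only [Matrix.vecMul, dotProduct, map_sum, map_mul, RingHom.mapMatrix_apply,
            Matrix.map_apply]
        rw [hg, hv, Matrix.vecMul_vecMul, Matrix.mul_adjugate, RingHom.map_det,
          Matrix.vecMul_smul, Matrix.vecMul_one, Pi.smul_apply, smul_eq_mul, mul_comm]
      · have h1 : (eval (ttEntries 1 T)).mapMatrix M = 1 := by
          rw [hM T hT]
          ext β γ
          rw [Matrix.of_apply, one_mul]
          exact hc β γ
        rw [RingHom.map_det, h1, Matrix.det_one]
        exact one_ne_zero

/-! ### The parametrization by normalized cores -/

/-- If `q ≤ p * k` and `p ≤ q * k`, some core has an identity submatrix both as a matrix with rows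
`(α, a)` and columns `β`, and as a matrix with rows `α` and columns `(a, β)`. -/
lemma exists_core {p q k : ℕ} (hp : 0 < p) (hq : 0 < q) (hqp : q ≤ p * k) (hpq : p ≤ q * k) :
    ∃ (T : Fin k → Matrix (Fin p) (Fin q) ℂ) (σ : Fin q → Fin p × Fin k)
      (τ : Fin p → Fin k × Fin q),
      (∀ β' β, T (σ β').2 (σ β').1 β = (1 : Matrix _ _ ℂ) β' β) ∧
      ∀ α α', T (τ α').1 α (τ α').2 = (1 : Matrix _ _ ℂ) α α' := by
  -- With `m = min p q`, the entry at `(a, α, β)` is `1` if `α ≡ β` modulo `m` and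
  -- `a = α / m + β / m`, where one of the two quotients is always `0`.
  obtain ⟨m, hm0, hmp, hmq, hpm, hqm⟩ : ∃ m, 0 < m ∧ m ≤ p ∧ m ≤ q ∧ p ≤ m * k ∧ q ≤ m * k := by
    have hk : 0 < k := Nat.pos_of_mul_pos_left (hq.trans_le hqp)
    rcases le_total p q with h | h
    · exact ⟨p, hp, le_rfl, h, Nat.le_mul_of_pos_right p hk, hqp⟩
    · exact ⟨q, hq, h, le_rfl, hpq, Nat.le_mul_of_pos_right q hk⟩
  have hmod : ∀ x, x % m < m := fun x => Nat.mod_lt x hm0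
  have hdiv : ∀ x, x % m / m = 0 := fun x => Nat.div_eq_of_lt (hmod x)
  refine ⟨fun a => Matrix.of fun α β =>
      if (α : ℕ) % m = β % m ∧ (a : ℕ) = α / m + β / m then 1 else 0,
    fun β => (⟨β % m, (hmod β).trans_le hmp⟩,
      ⟨β / m, Nat.div_lt_of_lt_mul (β.2.trans_le hqm)⟩),
    fun α => (⟨α / m, Nat.div_lt_of_lt_mul (α.2.trans_le hpm)⟩,
      ⟨α % m, (hmod α).trans_le hmq⟩), fun β' β => ?_, fun α α' => ?_⟩
  · change (if (β' : ℕ) % m % m = β % m ∧ (β' : ℕ) / m = β' % m / m + β / m then (1 : ℂ)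
      else 0) = _
    rw [Matrix.one_apply]
    refine if_congr ?_ rfl rfl
    simp only [Nat.mod_mod, hdiv, zero_add, Fin.ext_iff]
    refine ⟨fun ⟨h1, h2⟩ => ?_, fun h => by rw [h]; exact ⟨rfl, rfl⟩⟩
    rw [← Nat.div_add_mod (β' : ℕ) m, h1, h2, Nat.div_add_mod]
  · change (if (α : ℕ) % m = α' % m % m ∧ (α' : ℕ) / m = α / m + α' % m / m then (1 : ℂ)
      else 0) = _
    rw [Matrix.one_apply]
    refine if_congr ?_ rfl rfl
    simp only [Nat.mod_mod, hdiv, add_zero, Fin.ext_iff]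
    refine ⟨fun ⟨h1, h2⟩ => ?_, fun h => by rw [h]; exact ⟨rfl, rfl⟩⟩
    rw [← Nat.div_add_mod (α : ℕ) m, h1, ← h2, Nat.div_add_mod]

section Normalized

variable {m : ℕ} {k : Fin m → ℕ} {r : Fin (m + 1) → ℕ}
  (σ : (i : Fin m) → Fin (r i.succ) → Fin (r i.castSucc) × Fin (k i))

/-- The positions of the entries of normalized cores that normalization leaves free. -/
abbrev FreeIndex : Type :=
  Σ i : Fin m, {x : Fin (r i.castSucc) × Fin (k i) // x ∉ Set.range (σ i)} × Fin (r i.succ)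

open Classical in
/-- The normalized cores that differ from `T` by `b` in the free positions. -/
def coresOf (T : Cores k r) (b : FreeIndex σ → ℂ) : Cores k r := fun i a => Matrix.of fun α β =>
  T i a α β + if h : (α, a) ∉ Set.range (σ i) then b ⟨i, ⟨(α, a), h⟩, β⟩ else 0

lemma coresOf_zero (T : Cores k r) : coresOf σ T 0 = T := by
  funext i a
  ext α β
  simp [coresOf]

variable {σ}

lemma isNormalized_coresOf {T : Cores k r} (hT : IsNormalized σ T) (b : FreeIndex σ → ℂ) :
    IsNormalized σ (coresOf σ T b) := by
  intro i β' β
  rw [← hT i β' β, coresOf, Matrix.of_apply, dif_neg, add_zero]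
  exact fun h => h ⟨β', rfl⟩

lemma coresOf_apply_free (T : Cores k r) (b : FreeIndex σ → ℂ) (i : Fin m)
    (x : {x : Fin (r i.castSucc) × Fin (k i) // x ∉ Set.range (σ i)}) (β : Fin (r i.succ)) :
    coresOf σ T b i x.1.2 x.1.1 β = T i x.1.2 x.1.1 β + b ⟨i, x, β⟩ := by
  rw [coresOf, Matrix.of_apply, dif_pos x.2]

lemma exists_eq_coresOf {T A : Cores k r} (hT : IsNormalized σ T) (hA : IsNormalized σ A) :
    ∃ b, A = coresOf σ T b := by
  refine ⟨fun p => A p.1 p.2.1.1.2 p.2.1.1.1 p.2.2 - T p.1 p.2.1.1.2 p.2.1.1.1 p.2.2, ?_⟩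
  funext i a
  ext α β
  by_cases h : (α, a) ∈ Set.range (σ i)
  · obtain ⟨β', hβ'⟩ := h
    have h1 := hA i β' β
    have h2 := hT i β' β
    have h3 := isNormalized_coresOf hT
      (fun p => A p.1 p.2.1.1.2 p.2.1.1.1 p.2.2 - T p.1 p.2.1.1.2 p.2.1.1.1 p.2.2) i β' β
    rw [hβ'] at h1 h3
    exact h1.trans h3.symm
  · exact (((coresOf_apply_free T _ i ⟨(α, a), h⟩ β).trans (add_sub_cancel _ _))).symm

/-- The entries of `coresOf σ T b` are polynomials in `b`. -/
lemma exists_poly_coresOf (T : Cores k r) (i : Fin m) (a : Fin (k i)) (α : Fin (r i.castSucc))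
    (β : Fin (r i.succ)) :
    ∃ p : MvPolynomial (FreeIndex σ) ℂ, ∀ b, eval b p = coresOf σ T b i a α β := by
  by_cases h : (α, a) ∈ Set.range (σ i)
  · exact ⟨C (T i a α β), fun b => by
      rw [coresOf, Matrix.of_apply, dif_neg (not_not.2 h), add_zero, eval_C]⟩
  · exact ⟨C (T i a α β) + X ⟨i, ⟨(α, a), h⟩, β⟩, fun b => by
      rw [coresOf, Matrix.of_apply, dif_pos h, map_add, eval_C, eval_X]⟩

open Classical in
lemma card_freeIndex (hσ : ∀ i, Function.Injective (σ i)) :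
    Fintype.card (FreeIndex σ) =
      ∑ i : Fin m, (r i.castSucc * k i - r i.succ) * r i.succ := by
  rw [Fintype.card_sigma]
  refine Finset.sum_congr rfl fun i _ => ?_
  rw [Fintype.card_prod, Fintype.card_fin, Fintype.card_subtype_compl, Fintype.card_prod,
    Fintype.card_fin, Fintype.card_fin]
  congr 2
  exact (Set.card_range_of_injective (hσ i)).trans (Fintype.card_fin _)

end Normalized

/-! ### The tensor train variety -/

section Variety

variable {n : ℕ} {k : Fin (n + 1) → ℕ} {r : Fin (n + 2) → ℕ} (hr0 : r 0 = 1)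
  (hrn : r (Fin.last (n + 1)) = 1)

lemma smul_mem_range_ttTensor (t : ℂ) {v : ((i : Fin (n + 1)) → Fin (k i)) → ℂ}
    (hv : v ∈ Set.range (ttTensor (k := k) (r := r) hr0 hrn)) :
    t • v ∈ Set.range (ttTensor (k := k) (r := r) hr0 hrn) := by
  obtain ⟨A, rfl⟩ := hv
  let A' : Cores k r := Fin.cons (α := fun i : Fin (n + 1) =>
    Fin (k i) → Matrix (Fin (r i.castSucc)) (Fin (r i.succ)) ℂ) (fun a => t • A 0 a)
      (fun i => A i.succ)
  refine ⟨A', funext fun j => ?_⟩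
  exact congrFun (congrFun (Matrix.smul_mul t (A 0 (j 0))
    (ttMat (Cores.tail A) fun i => j i.succ)) _) _

lemma ttEntries_eq_ttTensor (t : ℂ) (A : Cores k r) :
    ttEntries t A = (t • ttTensor hr0 hrn A) ∘ Prod.fst := by
  funext ⟨j, α, ω⟩
  have hα : α = ⟨0, by omega⟩ := Fin.ext (by have := α.2; omega)
  have hω : ω = ⟨0, by omega⟩ := Fin.ext (by have := ω.2; omega)
  rw [hα, hω]
  rfl

/-- Polynomials that vanish on all multiples of normalized tensor trains vanish on all tensor
trains. -/
lemma eval_ttTensor_eq_zero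
    {σ : (i : Fin (n + 1)) → Fin (r i.succ) → Fin (r i.castSucc) × Fin (k i)}
    (hσ : ∀ i, Function.Injective (σ i)) {f : MvPolynomial ((i : Fin (n + 1)) → Fin (k i)) ℂ}
    (hf : ∀ (t : ℂ) (A : Cores k r), IsNormalized σ A → eval (t • ttTensor hr0 hrn A) f = 0)
    (A : Cores k r) : eval (ttTensor hr0 hrn A) f = 0 := by
  have h0 : 0 < r 0 := by omega
  have hn : 0 < r (Fin.last (n + 1)) := by omega
  have : Subsingleton (Fin (r (Fin.last (n + 1)))) := by rw [hrn]; infer_instance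
  have hZ : IsClosed {X : ((i : Fin (n + 1)) → Fin (k i)) →
      Matrix (Fin (r 0)) (Fin (r (Fin.last (n + 1)))) ℂ |
        eval (fun j => X j ⟨0, h0⟩ ⟨0, hn⟩) f = 0} := by
    refine isClosed_singleton.preimage ((MvPolynomial.continuous_eval f).comp
      (continuous_pi fun j => ?_))
    exact (continuous_apply _).matrix_elem _ _
  have := mem_of_isClosed_of_isNormalized σ hσ _ hZ (fun A hA G => ?_) A 1
  · simp only [Matrix.one_mul] at this
    exact this
  · have hG : (fun j => (ttMat A j * G) ⟨0, h0⟩ ⟨0, hn⟩) =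
        G ⟨0, hn⟩ ⟨0, hn⟩ • ttTensor hr0 hrn A := by
      funext j
      rw [Matrix.mul_apply, Fintype.sum_subsingleton _ ⟨0, hn⟩, mul_comm]
      rfl
    change eval (fun j => (ttMat A j * G) ⟨0, h0⟩ ⟨0, hn⟩) f = 0
    rw [hG]
    exact hf _ A hA

/-- The natural-number subtractions are exact by `hleft`. The last core is normalized as well; the
parameter that this removes returns as the scaling factor, the final `1`. -/
theorem ttVariety_dim (hr : ∀ i, 0 < r i)
    (hleft : ∀ i : Fin (n + 1), r i.succ ≤ r i.castSucc * k i)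
    (hright : ∀ i : Fin (n + 1), r i.castSucc ≤ r i.succ * k i) :
    affineDim (affineCone (ttVariety k r hr0 hrn)) =
        (∑ i : Fin (n + 1), (r i.castSucc * k i - r i.succ) * r i.succ + 1 : ℕ) ∧
      projDim (ttVariety k r hr0 hrn) + 1 =
        (∑ i : Fin (n + 1), (r i.castSucc * k i - r i.succ) * r i.succ + 1 : ℕ) := by
  classical
  choose T σ τ hT hτ using fun i : Fin (n + 1) =>
    exists_core (hr i.castSucc) (hr i.succ) (hleft i) (hright i)
  have hT' : IsNormalized σ T := hT
  have hσ := hT'.injective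
  choose θ hθ using fun j => exists_poly_ttMat (coresOf σ T) (exists_poly_coresOf T) j
    ⟨0, by omega⟩ ⟨0, by omega⟩
  have hpoly : ∀ b, polyMap θ b = ttTensor hr0 hrn (coresOf σ T b) :=
    fun b => funext fun j => hθ j b
  choose g h hgh hh using exists_recovery σ T hT' τ hτ
  have hV : ttVariety k r hr0 hrn = @closure _ (zariski _)
      (projOf (Set.range (ttTensor (k := k) (r := r) hr0 hrn))) := by
    let _ := zariski ((i : Fin (n + 1)) → Fin (k i))
    refine congrArg closure (Set.ext fun x => ?_)
    simp [projOf]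
  rw [hV, ← card_freeIndex hσ]
  refine dim_of_parametrization θ
    (fun p => rename Prod.fst (g p.1 p.2.1.1.2 p.2.1.1.1 p.2.2) -
      C (T p.1 p.2.1.1.2 p.2.1.1.1 p.2.2) *
        rename Prod.fst (h p.1 p.2.1.1.2 p.2.1.1.1 p.2.2))
    (fun p => rename Prod.fst (h p.1 p.2.1.1.2 p.2.1.1.1 p.2.2)) ?_ ?_ ?_
    (fun t v hv => smul_mem_range_ttTensor hr0 hrn t hv) ?_ ?_
  · rintro ⟨i, x, β⟩ t b
    have := hgh i x.1.2 x.1.1 β _ (isNormalized_coresOf hT' b) t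
    rw [coresOf_apply_free] at this
    rw [map_sub, map_mul, eval_C, eval_rename, eval_rename, hpoly, ← ttEntries_eq_ttTensor, this]
    ring
  · rintro ⟨i, x, β⟩
    have := hh i x.1.2 x.1.1 β
    rwa [ttEntries_eq_ttTensor hr0 hrn, one_smul, ← eval_rename, ← coresOf_zero σ T,
      ← hpoly] at this
  · obtain ⟨c, hc⟩ := exists_columns T τ hτ
    intro h0
    rw [hpoly, coresOf_zero] at h0
    have h1 := congrFun (ttEntries_eq_ttTensor hr0 hrn 1 T)
      ((c ⟨0, by omega⟩).1, ⟨0, by omega⟩, (c ⟨0, by omega⟩).2)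
    rw [h0, smul_zero, ttEntries, hc] at h1
    simp at h1
  · exact fun b => ⟨_, (hpoly b).symm⟩
  · rintro f hf _ ⟨A, rfl⟩
    refine eval_ttTensor_eq_zero hr0 hrn hσ (fun t A hA => ?_) A
    obtain ⟨b, rfl⟩ := exists_eq_coresOf hT' hA
    rw [← hpoly]
    exact hf t b

end Variety

end TensorTrain

end

theorem corollary3p3 (n : ℕ) (k : Fin (n + 1) → ℕ) (r : Fin (n + 2) → ℕ)
    (hk : ∀ i, 0 < k i) (hr : ∀ i, 0 < r i)
    (hr0 : r 0 = 1) (hrn : r (Fin.last (n + 1)) = 1)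
    (hleft : ∀ i : Fin (n + 1), r i.succ ≤ r i.castSucc * k i)
    (hright : ∀ i : Fin (n + 1), r i.castSucc ≤ r i.succ * k i) :
    ∃ d : ℕ,
      (d : ℤ) =
        (∑ i : Fin n, ((r i.castSucc.castSucc : ℤ) * k i.castSucc - r i.castSucc.succ) *
          r i.castSucc.succ) + (r (Fin.last n).castSucc : ℤ) * k (Fin.last n) ∧
      TensorTrain.affineDim (TensorTrain.affineCone (TensorTrain.ttVariety k r hr0 hrn)) = d ∧
      TensorTrain.projDim (TensorTrain.ttVariety k r hr0 hrn) + 1 = d := by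
  refine ⟨_, ?_, TensorTrain.ttVariety_dim hr0 hrn hr hleft hright⟩
  -- Since `r (Fin.last (n + 1)) = 1`, the last summand plus `1` is `r_n * k_n`.
  rw [Nat.cast_add, Nat.cast_sum, Fin.sum_univ_castSucc, Nat.cast_one, add_assoc]
  congr 1
  · refine Finset.sum_congr rfl fun i _ => ?_
    rw [Nat.cast_mul, Nat.cast_sub (hleft _), Nat.cast_mul]
  · rw [Nat.cast_mul, Nat.cast_sub (hleft _), Nat.cast_mul, Fin.succ_last, hrn]
    push_cast
    ring
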